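/- Let $1\le p\le\infty$, $n\in\mathbb N$, $\lambda>0$, and let $w_1,\dots,w_n\ge 0$ be a fixed weight sequence. The inhomogeneous random graph $G_{\mathrm{IRG}}=\mathrm{IRG}(\{w\}_1^n)$ is the random graph on the vertex set $\{1,\dots,n\}$ in which the edges $\{u,v\}$, $u\ne v$, are present independently, with probability $\min\{1,\lambda w_uw_v/n\}$. For $d\ge 1$, let $\mathbb T^d=(\mathbb R/\mathbb Z)^d$ be the torus with the uniform (Lebesgue) probability measure and the distance $\|x-y\|_p=\bigl(\sum_{i=1}^d|x_i-y_i|_C^p\bigr)^{1/p}$ if $p<\infty$ and $\|x-y\|_\infty=\max_{1\le i\le d}|x_i-y_i|_C$ if $p=\infty$, where $|a-b|_C=\min\{|a-b|,1-|a-b|\}$ for $a,b\in[0,1)$ is the distance on the circle. The standard geometric inhomogeneous random graph $G_{\mathrm{GIRG}}=\mathrm{GIRG}(\{w\}_1^n,d)$ with the $L_p$-norm is the random graph on $\{1,\dots,n\}$ obtained by drawing positions $\mathbf x_1,\dots,\mathbf x_n$ independently and uniformly from $\mathbb T^d$ and joining $u\ne v$ if and only if $\|\mathbf x_u-\mathbf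 x_v\|_p\le t_{uv}$. Here the connection threshold is $t_{uv}=\frac12\bigl(\lambda w_uw_v/n\bigr)^{1/d}$ if $p=\infty$; if $p<\infty$, then $t_{uv}$ is the least $r\ge 0$ for which the ball $\{x\in\mathbb T^d:\|x\|_p\le r\}$ has volume $\min\{1,\lambda w_uw_v/n\}$. (In both cases $u$ and $v$ are adjacent with probability $\min\{1,\lambda w_uw_v/n\}$.) The total variation distance of two random graphs $G_1,G_2$ on $\{1,\dots,n\}$ is $\|G_1,G_2\|_{\mathrm{TV}}=\sup_A|\Pr(G_1\in A)-\Pr(G_2\in A)|$, where $A$ ranges over all sets of graphs on $\{1,\dots,n\}$. Then, with $p$, $n$, $\lambda$ and the weights fixed, $$\lim_{d\to\infty}\|G_{\mathrm{GIRG}},G_{\mathrm{IRG}}\|_{\mathrm{TV}}=0 .$$ -/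

import Mathlib

open MeasureTheory ProbabilityTheory Filter Topology
open scoped ENNReal

noncomputable section

namespace GIRG

/-- Total variation distance of two (probability) measures:
`sup_A |μ(A) - ν(A)|` over all measurable sets `A`. -/
def tvDist {Ω : Type*} [MeasurableSpace Ω] (μ ν : Measure Ω) : ℝ :=
  ⨆ A : {A : Set Ω // MeasurableSet A}, |μ.real A - ν.real A|

/-- The `L_p`-distance on the `d`-dimensional unit torus `(ℝ/ℤ)^d`. The norm on `UnitAddCircle`
is the distance to `0` on the circle of circumference one, so that `‖a - b‖` is
`min (|a - b|) (1 - |a - b|)` for representatives `a, b ∈ [0,1]`. -/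
def lpDist (p : ℝ≥0∞) {d : ℕ} (x y : UnitAddTorus (Fin d)) : ℝ :=
  if p = ∞ then ⨆ i, ‖x i - y i‖
  else (∑ i, ‖x i - y i‖ ^ p.toReal) ^ (1 / p.toReal)

/-- The volume `ν(r)` of a ball of radius `r` in the `d`-dimensional torus with the
`L_p`-distance. -/
def ballVolume (p : ℝ≥0∞) (d : ℕ) (r : ℝ) : ℝ :=
  (volume : Measure (UnitAddTorus (Fin d))).real {x | lpDist p x 0 ≤ r}

/-- The number `λ w_u w_v / n`. -/
def ratio {n : ℕ} (lam : ℝ) (w : Fin n → ℝ) (u v : Fin n) : ℝ :=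
  lam * w u * w v / n

theorem ratio_comm {n : ℕ} (lam : ℝ) (w : Fin n → ℝ) (u v : Fin n) :
    ratio lam w u v = ratio lam w v u := by
  unfold ratio; ring

theorem lpDist_comm (p : ℝ≥0∞) {d : ℕ} (x y : UnitAddTorus (Fin d)) :
    lpDist p x y = lpDist p y x := by
  simp only [lpDist, norm_sub_rev]

/-- The connection threshold, as a function of `q = λ w_u w_v / n`. For `p = ∞` it is
`q^(1/d) / 2`; for `p < ∞` it is the least radius `r ≥ 0` of a ball of volume `min {1, q}`,
which makes the marginal connection probability equal to `min {1, q}`. -/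
def threshold (p : ℝ≥0∞) (d : ℕ) (q : ℝ) : ℝ :=
  if p = ∞ then 1 / 2 * q ^ (1 / (d : ℝ))
  else sInf {r : ℝ | 0 ≤ r ∧ ballVolume p d r = min 1 q}

/-- The geometric graph on the vertices `Fin n` with positions `x`: distinct vertices `u, v` are
adjacent iff their `L_p`-distance is at most their connection threshold. -/
def geomGraph {n : ℕ} (p : ℝ≥0∞) (d : ℕ) (lam : ℝ) (w : Fin n → ℝ)
    (x : Fin n → UnitAddTorus (Fin d)) : SimpleGraph (Fin n) where
  Adj u v := u ≠ v ∧ lpDist p (x u) (x v) ≤ threshold p d (ratio lam w u v)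
  symm := ⟨fun u v h => ⟨h.1.symm, by rw [lpDist_comm, ratio_comm]; exact h.2⟩⟩
  loopless := ⟨fun _ h => h.1 rfl⟩

/-- The law of the standard geometric inhomogeneous random graph: the positions of the vertices are
independent and uniform on the torus. -/
def girgLaw {n : ℕ} (p : ℝ≥0∞) (d : ℕ) (lam : ℝ) (w : Fin n → ℝ) :
    Measure (SimpleGraph (Fin n)) :=
  (volume : Measure (Fin n → UnitAddTorus (Fin d))).map (geomGraph p d lam w)

/-- The connection probability of the pair `e = {u, v}` in the inhomogeneous random graph: the
projection of `λ w_u w_v / n` to `[0,1]`, which is `min {1, λ w_u w_v / n}` as the weights are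
nonnegative. -/
def edgeProb {n : ℕ} (lam : ℝ) (w : Fin n → ℝ) (e : Sym2 (Fin n)) : unitInterval :=
  Set.projIcc 0 1 zero_le_one (Sym2.lift ⟨ratio lam w, ratio_comm lam w⟩ e)

/-- The law of the inhomogeneous random graph: the edges are present independently, each with
its connection probability (the loops among the pairs are discarded by `fromEdgeSet`). -/
def irgLaw {n : ℕ} (lam : ℝ) (w : Fin n → ℝ) : Measure (SimpleGraph (Fin n)) :=
  (Measure.pi fun e : Sym2 (Fin n) => bernoulliMeasure True False (edgeProb lam w e)).map
    fun s => SimpleGraph.fromEdgeSet {e | s e}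

end GIRG

end

/-!
A random graph on a fixed finite vertex set is determined by the probabilities `Pr(H ≤ G)` that it
contains a given graph `H` (`tendsto_singleton_of_tendsto_Ici`). Write `q_e` for the connection
probability of the pair `e`. In the inhomogeneous random graph, `Pr(H ≤ G)` is the product of the
`q_e` over the edges of `H`, so it suffices that in the geometric graph the edges of `H` become
independent as `d → ∞` (`tendsto_volume_real_forall_lpDist_le_threshold`).

In a single coordinate, the differences `x_u - x_v` and `x_a - x_b` along distinct pairs of
vertices are uniform and independent: together they form a surjective homomorphism of compact
groups, which preserves Haar measure (`measurePreserving_sub_eval_prodMk`). The differences along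
all edges of `H` are only pairwise independent, since they sum to zero along a cycle, but pairwise
independence is enough in high dimension.

For `p = ∞`, all edges of `H` are present iff in no coordinate a difference exceeds its threshold.
If all `q_e` are positive, one coordinate fails for the edge `e` with probability
`1 - q_e^(1/d) ≈ -log q_e / d`, and for two edges at once with probability `O(1/d²)`, so that the
probability of success is
`(1 + (∑ log q_e) / d + o(1/d))^d → ∏ q_e` (`tendsto_measureReal_norm_le_pow`).

For `p < ∞`, the `p`-th powers of the distances along the edges of `H` are sums of `d` independent
copies of a random vector with uncorrelated coordinates. By the multivariate central limit theorem
(`tendsto_normalizedLaw`, from the one-dimensional one through characteristic functions) the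
rescaled sums converge to independent Gaussian variables. The thresholds are known only through the
marginal probabilities, which are exactly the `q_e` (`threshold_mem`); as sublevel sets of
one function are nested, marginal probabilities control joint ones
(`tendsto_measureReal_orthant_of_marginals`).
-/

/-! ### Differences of uniform positions -/

instance UnitAddCircle.instIsProbabilityMeasure :
    IsProbabilityMeasure (volume : Measure UnitAddCircle) := ⟨UnitAddCircle.measure_univ⟩

instance MeasureTheory.isProbabilityMeasure_volume_pi {ι : Type*} [Fintype ι] {α : ι → Type*}
    [∀ i, MeasureSpace (α i)] [∀ i, IsProbabilityMeasure (volume : Measure (α i))] :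
    IsProbabilityMeasure (volume : Measure (∀ i, α i)) :=
  inferInstanceAs (IsProbabilityMeasure (Measure.pi fun _ => volume))

section
variable {K : Type*} [AddCommGroup K] [TopologicalSpace K] [IsTopologicalAddGroup K]
  [CompactSpace K] [SecondCountableTopology K] [MeasureSpace K] [BorelSpace K]
  [(volume : Measure K).IsAddHaarMeasure] [IsProbabilityMeasure (volume : Measure K)]
  {ι κ : Type*} [Fintype ι] [Fintype κ]

theorem measurePreserving_sub_eval {u v : ι} (h : u ≠ v) :
    MeasurePreserving (fun x : ι → K => x u - x v) := by
  classical
  refine AddMonoidHom.measurePreserving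
    (f := Pi.evalAddMonoidHom (fun _ : ι => K) u - Pi.evalAddMonoidHom (fun _ : ι => K) v)
    (by change Continuous fun x : ι → K => x u - x v; fun_prop) (fun a => ?_) (by simp)
  exact ⟨Pi.single u a, by simp [h.symm]⟩

/-- Two differences along distinct unordered pairs `{a, b} ≠ {u, v}` are independent and uniform:
one of `u, v` lies outside `{a, b}`, so that the joint map is a surjective homomorphism. -/
theorem measurePreserving_sub_eval_prodMk {a b u v : ι} (hab : a ≠ b) (huv : u ≠ v)
    (h : s(a, b) ≠ s(u, v)) :
    MeasurePreserving (fun x : ι → K => (x a - x b, x u - x v)) := by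
  classical
  refine AddMonoidHom.measurePreserving (ν := (volume : Measure K).prod volume)
    (f := (Pi.evalAddMonoidHom (fun _ : ι => K) a - Pi.evalAddMonoidHom (fun _ : ι => K) b).prod
      (Pi.evalAddMonoidHom (fun _ : ι => K) u - Pi.evalAddMonoidHom (fun _ : ι => K) v))
    (by change Continuous fun x : ι → K => (x a - x b, x u - x v); fun_prop)
    (fun ⟨r, s⟩ => ?_) (by simp)
  have hout : (u ≠ a ∧ u ≠ b) ∨ (v ≠ a ∧ v ≠ b) := by
    by_contra hc
    apply h
    rw [Sym2.eq_iff]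
    grind
  -- Place `a` at `r` and `b` at `0`; the vertex outside `{a, b}` then adjusts the other difference.
  have hcases : ∃ x : ι → K, x a - x b = r ∧ x u - x v = s := by
    rcases hout with hu | hv
    · refine ⟨fun i => if i = a then r else if i = b then 0 else if i = u then
        s + (if v = a then r else 0) else 0, ?_, ?_⟩ <;> grind
    · refine ⟨fun i => if i = a then r else if i = b then 0 else if i = v then
        (if u = a then r else 0) - s else 0, ?_, ?_⟩ <;> grind
  obtain ⟨x, h1, h2⟩ := hcases
  exact ⟨x, Prod.ext h1 h2⟩

theorem measurePreserving_add_single [DecidableEq ι] (i : ι) :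
    MeasurePreserving (fun z : (ι → K) × K => z.1 + Pi.single i z.2)
      ((volume : Measure (ι → K)).prod (volume : Measure K)) := by
  refine AddMonoidHom.measurePreserving (μ := (volume : Measure (ι → K)).prod (volume : Measure K))
    (f := AddMonoidHom.fst (ι → K) K +
      (AddMonoidHom.single (fun _ : ι => K) i).comp (AddMonoidHom.snd (ι → K) K))
    ?_ (fun x => ⟨(x, 0), by simp⟩) (by simp)
  change Continuous fun z : (ι → K) × K => z.1 + Pi.single i z.2
  exact continuous_fst.add ((continuous_single i).comp continuous_snd)

theorem measurePreserving_swap_pi :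
    MeasurePreserving (fun (x : κ → ι → K) i k => x k i) := by
  refine AddMonoidHom.measurePreserving
    (f := { toFun := fun (x : κ → ι → K) i k => x k i
            map_zero' := rfl
            map_add' := fun _ _ => rfl })
    (by change Continuous (fun (x : κ → ι → K) i k => x k i); fun_prop) (fun a => ?_) (by simp)
  exact ⟨fun k i => a i k, rfl⟩
end

/-! ### Total variation on finite spaces -/

instance SimpleGraph.instMeasurableSingletonClass {V : Type*} [Countable V] :
    MeasurableSingletonClass (SimpleGraph V) where
  measurableSet_singleton G := by
    have h : ({G} : Set (SimpleGraph V)) = SimpleGraph.edgeSet ⁻¹' {G.edgeSet} := by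
      ext H; simp
    rw [h]
    have : MeasurableSet ({G.edgeSet} : Set (Set (Sym2 V))) := measurableSet_singleton _
    exact SimpleGraph.measurable_edgeSet this

namespace GIRG

theorem measureReal_eq_sum_singleton {Ω : Type*} [Fintype Ω] [MeasurableSpace Ω]
    [MeasurableSingletonClass Ω] (μ : Measure Ω) [IsFiniteMeasure μ] (A : Set Ω)
    [DecidablePred (· ∈ A)] :
    μ.real A = ∑ a with a ∈ A, μ.real {a} := by
  rw [sum_measureReal_singleton]; simp

theorem tvDist_le_sum {Ω : Type*} [Fintype Ω] [MeasurableSpace Ω]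
    [MeasurableSingletonClass Ω] (μ ν : Measure Ω) [IsFiniteMeasure μ] [IsFiniteMeasure ν] :
    tvDist μ ν ≤ ∑ a, |μ.real {a} - ν.real {a}| := by
  classical
  refine Real.iSup_le (fun A => ?_) (Finset.sum_nonneg fun _ _ => abs_nonneg _)
  rw [measureReal_eq_sum_singleton μ, measureReal_eq_sum_singleton ν, ← Finset.sum_sub_distrib]
  exact (Finset.abs_sum_le_sum_abs _ _).trans
    (Finset.sum_le_sum_of_subset_of_nonneg (Finset.subset_univ _) fun _ _ _ => abs_nonneg _)

theorem tendsto_tvDist_of_tendsto_singleton {Ω : Type*} [Finite Ω] [MeasurableSpace Ω]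
    [MeasurableSingletonClass Ω] {μ : ℕ → Measure Ω} {ν : Measure Ω}
    [∀ d, IsFiniteMeasure (μ d)] [IsFiniteMeasure ν]
    (h : ∀ a, Tendsto (fun d => (μ d).real {a}) atTop (𝓝 (ν.real {a}))) :
    Tendsto (fun d => tvDist (μ d) ν) atTop (𝓝 0) := by
  have := Fintype.ofFinite Ω
  refine squeeze_zero (fun d => Real.iSup_nonneg fun _ => abs_nonneg _)
    (fun d => tvDist_le_sum (μ d) ν) ?_
  rw [← Finset.sum_const_zero (s := (Finset.univ : Finset Ω))]
  refine tendsto_finsetSum _ fun a _ => ?_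
  simpa using ((h a).sub_const (ν.real {a})).abs

/-- Möbius inversion on a finite poset, in the limit: a singleton is an upper interval minus the
singletons strictly above it. -/
theorem tendsto_singleton_of_tendsto_Ici {Ω : Type*} [Finite Ω] [PartialOrder Ω]
    [MeasurableSpace Ω] [MeasurableSingletonClass Ω] {μ : ℕ → Measure Ω} {ν : Measure Ω}
    [∀ d, IsFiniteMeasure (μ d)] [IsFiniteMeasure ν]
    (h : ∀ a, Tendsto (fun d => (μ d).real (Set.Ici a)) atTop (𝓝 (ν.real (Set.Ici a)))) (a : Ω) :
    Tendsto (fun d => (μ d).real {a}) atTop (𝓝 (ν.real {a})) := by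
  classical
  have := Fintype.ofFinite Ω
  have key (ρ : Measure Ω) [IsFiniteMeasure ρ] (a : Ω) :
      ρ.real {a} = ρ.real (Set.Ici a) - ∑ b with b ∈ Set.Ioi a, ρ.real {b} := by
    rw [← measureReal_eq_sum_singleton, ← Set.Ioi_insert, Set.insert_eq,
      measureReal_union (by simp) (Set.toFinite _).measurableSet]
    ring
  induction a using WellFoundedGT.induction with
  | ind a ih =>
    simp_rw [key _ a]
    exact (h a).sub (tendsto_finsetSum _ fun b hb => ih b (by simpa using hb))

/-! ### The upper sets of graphs under the two laws -/

theorem measurable_lpDist (p : ℝ≥0∞) {d : ℕ} :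
    Measurable fun z : UnitAddTorus (Fin d) × UnitAddTorus (Fin d) => lpDist p z.1 z.2 := by
  have hsub : Measurable fun z : UnitAddCircle × UnitAddCircle => ‖z.1 - z.2‖ :=
    Continuous.measurable (by fun_prop)
  have hi (i : Fin d) : Measurable
      fun z : UnitAddTorus (Fin d) × UnitAddTorus (Fin d) => ‖z.1 i - z.2 i‖ :=
    hsub.comp (f := fun z : UnitAddTorus (Fin d) × UnitAddTorus (Fin d) => (z.1 i, z.2 i))
      (by fun_prop)
  unfold lpDist
  split_ifs
  · exact Measurable.iSup fun i => hi i
  · exact (Finset.measurable_sum _ fun i _ => (hi i).pow_const _).pow_const _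

theorem measurable_geomGraph {n : ℕ} (p : ℝ≥0∞) (d : ℕ) (lam : ℝ) (w : Fin n → ℝ) :
    Measurable (geomGraph p d lam w) := by
  rw [SimpleGraph.measurable_iff_adj]
  intro u v
  have : Measurable fun x : Fin n → UnitAddTorus (Fin d) => lpDist p (x u) (x v) :=
    (measurable_lpDist p).comp (f := fun x : Fin n → UnitAddTorus (Fin d) => (x u, x v))
      (by fun_prop)
  exact measurable_const.and (measurableSet_setOfPred.1 (measurableSet_le this measurable_const))

instance {n : ℕ} (p : ℝ≥0∞) (d : ℕ) (lam : ℝ) (w : Fin n → ℝ) :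
    IsProbabilityMeasure (girgLaw p d lam w) :=
  Measure.isProbabilityMeasure_map (measurable_geomGraph p d lam w).aemeasurable

theorem measurable_fromEdgeSet_setOf {V : Type*} :
    Measurable fun s : Sym2 V → Prop => SimpleGraph.fromEdgeSet {e | s e} :=
  SimpleGraph.measurable_fromEdgeSet

instance {n : ℕ} (lam : ℝ) (w : Fin n → ℝ) : IsProbabilityMeasure (irgLaw lam w) :=
  Measure.isProbabilityMeasure_map measurable_fromEdgeSet_setOf.aemeasurable

theorem girgLaw_real_Ici {n : ℕ} (p : ℝ≥0∞) (d : ℕ) (lam : ℝ) (w : Fin n → ℝ)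
    (H : SimpleGraph (Fin n)) :
    (girgLaw p d lam w).real (Set.Ici H) =
      (volume : Measure (Fin n → UnitAddTorus (Fin d))).real
        {x | ∀ u v, H.Adj u v → lpDist p (x u) (x v) ≤ threshold p d (ratio lam w u v)} := by
  rw [girgLaw, map_measureReal_apply (measurable_geomGraph p d lam w)
    (Set.toFinite _).measurableSet]
  congr 1
  ext x
  simp only [Set.mem_preimage, Set.mem_Ici, Set.mem_ofPred_eq, SimpleGraph.le_iff_adj]
  exact forall₃_congr fun u v h => ⟨fun h' => h'.2, fun h' => ⟨h.ne, h'⟩⟩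

theorem irgLaw_real_Ici {n : ℕ} (lam : ℝ) (w : Fin n → ℝ) (H : SimpleGraph (Fin n))
    [Fintype H.edgeSet] :
    (irgLaw lam w).real (Set.Ici H) = ∏ e : H.edgeSet, (edgeProb lam w e : ℝ) := by
  classical
  have hpre : (fun s : Sym2 (Fin n) → Prop => SimpleGraph.fromEdgeSet {e | s e}) ⁻¹' Set.Ici H =
      Set.univ.pi fun e => if e ∈ H.edgeSet then {True} else Set.univ := by
    ext s
    simp only [Set.mem_preimage, Set.mem_Ici, Set.mem_univ_pi]
    rw [← SimpleGraph.edgeSet_subset_edgeSet, SimpleGraph.edgeSet_fromEdgeSet]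
    refine ⟨fun h e => ?_, fun h e he => ⟨?_, ?_⟩⟩
    · split_ifs with he
      · simpa using (h he).1
      · trivial
    · simpa [he] using h e
    · exact H.not_isDiag_of_mem_edgeSet he
  rw [irgLaw, map_measureReal_apply measurable_fromEdgeSet_setOf
    (Set.toFinite _).measurableSet, hpre, measureReal_def, Measure.pi_pi, ENNReal.toReal_prod]
  have hfac (e : Sym2 (Fin n)) :
      (bernoulliMeasure True False (edgeProb lam w e)
        (if e ∈ H.edgeSet then {True} else Set.univ)).toReal =
      if e ∈ H.edgeSet then (edgeProb lam w e : ℝ) else 1 := by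
    split_ifs with he
    · rw [← measureReal_def, bernoulliMeasure_real_apply _ (measurableSet_singleton _)]
      simp
    · simp
  simp_rw [hfac]
  rw [Finset.prod_ite, Finset.prod_const_one, mul_one,
    ← Finset.prod_subtype (p := (· ∈ H.edgeSet)) (f := fun e => (edgeProb lam w e : ℝ))]
  simp

/-! ### Rare pairwise independent events -/

section
variable {Ω ι : Type*} [MeasurableSpace Ω] {P : Measure Ω} [IsProbabilityMeasure P]
  {A : ι → ℕ → Set Ω} {c : ι → ℝ}

/-- If the events `A e d` have probability `c e / d + o(1/d)` and are pairwise independent, the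
overlaps have probability `O(1/d²)`, so that the union has probability `(∑ c e) / d + o(1/d)`. -/
theorem tendsto_mul_measureReal_biUnion (hA : ∀ e d, MeasurableSet (A e d))
    (hc : ∀ e, Tendsto (fun d : ℕ => d * P.real (A e d)) atTop (𝓝 (c e)))
    (hind : ∀ e f, e ≠ f → ∀ d, P.real (A e d ∩ A f d) = P.real (A e d) * P.real (A f d))
    (s : Finset ι) :
    Tendsto (fun d : ℕ => d * P.real (⋃ e ∈ s, A e d)) atTop (𝓝 (∑ e ∈ s, c e)) := by
  classical
  induction s using Finset.induction_on with
  | empty => simp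
  | insert a s ha ih =>
    have h0 (e : ι) : Tendsto (fun d : ℕ => P.real (A e d)) atTop (𝓝 0) := by
      have := (tendsto_inv_atTop_nhds_zero_nat (𝕜 := ℝ)).mul (hc e)
      rw [zero_mul] at this
      refine this.congr' ?_
      filter_upwards [eventually_ne_atTop 0] with d hd
      field_simp
    have hU (d : ℕ) : MeasurableSet (⋃ e ∈ s, A e d) := s.measurableSet_biUnion fun e _ => hA e d
    have hinter : Tendsto (fun d : ℕ => d * P.real (A a d ∩ ⋃ e ∈ s, A e d)) atTop (𝓝 0) := by
      have hb : Tendsto (fun d : ℕ => ∑ e ∈ s, d * P.real (A a d) * P.real (A e d)) atTop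
          (𝓝 (∑ e ∈ s, c a * 0)) := tendsto_finsetSum _ fun e _ => (hc a).mul (h0 e)
      rw [mul_zero, Finset.sum_const_zero] at hb
      refine squeeze_zero (fun d => by positivity) (fun d => ?_) hb
      simp_rw [mul_assoc, ← Finset.mul_sum]
      gcongr
      rw [Set.inter_iUnion₂, Finset.mul_sum]
      refine (measureReal_biUnion_finset_le _ _).trans (Finset.sum_le_sum fun e he => ?_)
      exact (hind a e (by rintro rfl; exact ha he) d).le
    rw [Finset.sum_insert ha, ← sub_zero (c a + _)]
    refine (((hc a).add ih).sub hinter).congr fun d => ?_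
    have := measureReal_union_add_inter (μ := P) (s := A a d) (hU d)
      (measure_ne_top _ _) (measure_ne_top _ _)
    rw [Finset.set_biUnion_insert]
    linear_combination -(d : ℝ) * this

theorem tendsto_measureReal_iInter_compl_pow [Fintype ι] (hA : ∀ e d, MeasurableSet (A e d))
    (hc : ∀ e, Tendsto (fun d : ℕ => d * P.real (A e d)) atTop (𝓝 (c e)))
    (hind : ∀ e f, e ≠ f → ∀ d, P.real (A e d ∩ A f d) = P.real (A e d) * P.real (A f d)) :
    Tendsto (fun d : ℕ => P.real (⋂ e, (A e d)ᶜ) ^ d) atTop (𝓝 (∏ e, Real.exp (-c e))) := by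
  have h := tendsto_mul_measureReal_biUnion hA hc hind Finset.univ
  rw [← Real.exp_sum, Finset.sum_neg_distrib]
  refine (Real.tendsto_one_add_pow_exp_of_tendsto
    (g := fun d => -P.real (⋃ e, A e d)) ?_).congr fun d => ?_
  · simpa using h.neg
  · rw [← Set.compl_iUnion, probReal_compl_eq_one_sub (MeasurableSet.iUnion fun e => hA e d)]
    ring

end

/-! ### The maximum norm -/

theorem volume_real_lt_norm {t : ℝ} (ht : 0 ≤ t) :
    (volume : Measure UnitAddCircle).real {y | t < ‖y‖} = 1 - min 1 (2 * t) := by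
  have h : {y : UnitAddCircle | t < ‖y‖} = (Metric.closedBall 0 t)ᶜ := by ext; simp
  rw [h, probReal_compl_eq_one_sub measurableSet_closedBall, measureReal_def,
    AddCircle.volume_closedBall, ENNReal.toReal_ofReal (by positivity)]

theorem tendsto_nat_mul_one_sub_rpow {q : ℝ} (hq : 0 < q) :
    Tendsto (fun d : ℕ => d * (1 - q ^ (1 / (d : ℝ)))) atTop (𝓝 (-Real.log q)) := by
  have h : Tendsto (fun d : ℕ => (d : ℝ)⁻¹) atTop (𝓝[>] 0) :=
    tendsto_inv_atTop_nhdsGT_zero.comp tendsto_natCast_atTop_atTop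
  refine ((tendsto_rpow_sub_one_log hq).comp h).neg.congr fun d => ?_
  simp only [Function.comp_apply, inv_inv, one_div]
  ring

theorem tendsto_measureReal_norm_le_pow {Ω ι : Type*} [MeasurableSpace Ω] {P : Measure Ω}
    [IsProbabilityMeasure P] [Fintype ι] {Y : ι → Ω → UnitAddCircle}
    (hY : ∀ e, MeasurePreserving (Y e) P) (hind : ∀ e f, e ≠ f → IndepFun (Y e) (Y f) P)
    {q : ι → ℝ} (hq : ∀ e, 0 ≤ q e) :
    Tendsto (fun d : ℕ => P.real {ω | ∀ e, ‖Y e ω‖ ≤ 1 / 2 * q e ^ (1 / (d : ℝ))} ^ d) atTop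
      (𝓝 (∏ e, min 1 (q e))) := by
  have hmeas (t : ℝ) : MeasurableSet {y : UnitAddCircle | t < ‖y‖} :=
    measurableSet_lt measurable_const continuous_norm.measurable
  have hprob (e : ι) (d : ℕ) : P.real (Y e ⁻¹' {y | 1 / 2 * q e ^ (1 / (d : ℝ)) < ‖y‖}) =
      1 - (min 1 (q e)) ^ (1 / (d : ℝ)) := by
    have := hq e
    rw [(hY e).measureReal_preimage (hmeas _).nullMeasurableSet,
      volume_real_lt_norm (by positivity), ← mul_assoc, mul_one_div_cancel two_ne_zero, one_mul]
    congr 1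
    rcases le_total 1 (q e) with h | h
    · rw [min_eq_left h, Real.one_rpow, min_eq_left (Real.one_le_rpow h (by positivity))]
    · rw [min_eq_right h, min_eq_right (Real.rpow_le_one this h (by positivity))]
  by_cases hpos : ∀ e, 0 < q e
  · have key := tendsto_measureReal_iInter_compl_pow (P := P)
      (A := fun e (d : ℕ) => Y e ⁻¹' {y | 1 / 2 * q e ^ (1 / (d : ℝ)) < ‖y‖})
      (c := fun e => -Real.log (min 1 (q e))) (fun e d => (hY e).measurable (hmeas _))
      (fun e => by
        simp_rw [hprob]
        exact tendsto_nat_mul_one_sub_rpow (lt_min one_pos (hpos e)))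
      (fun e f hef d => by
        simp_rw [measureReal_def]
        rw [(hind e f hef).measure_inter_preimage_eq_mul _ _ (hmeas _) (hmeas _),
          ENNReal.toReal_mul])
    simp_rw [neg_neg] at key
    have hexp (e : ι) : Real.exp (Real.log (min 1 (q e))) = min 1 (q e) :=
      Real.exp_log (lt_min one_pos (hpos e))
    simp_rw [hexp] at key
    refine key.congr fun d => ?_
    congr 2
    ext ω
    simp
  · -- Some `q e` vanishes: for positive `d` the radius is zero, and both sides vanish.
    push Not at hpos
    obtain ⟨e, he⟩ := hpos
    have he0 : q e = 0 := le_antisymm he (hq e)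
    rw [Finset.prod_eq_zero (Finset.mem_univ e) (by simp [he0])]
    refine tendsto_const_nhds.congr' ?_
    filter_upwards [eventually_ne_atTop 0] with d hd
    refine (pow_eq_zero_iff hd |>.2 ?_).symm
    refine le_antisymm ?_ measureReal_nonneg
    have h1 := hprob e d
    rw [he0, min_eq_right zero_le_one, Real.zero_rpow (by positivity), sub_zero] at h1
    have h2 := probReal_compl_eq_one_sub (μ := P) ((hY e).measurable
      (hmeas (1 / 2 * 0)))
    rw [h1, sub_self] at h2
    rw [← h2]
    refine measureReal_mono fun ω hω => ?_
    have := hω e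
    rw [he0, Real.zero_rpow (by positivity)] at this
    simpa using this

/-! ### A multivariate central limit theorem -/

section
variable {Ω ι : Type*} [MeasurableSpace Ω] {P : Measure Ω} {X : ι → Ω → ℝ}

/-- The vector of the centered and rescaled partial sums of `d` independent samples of the random
vector `X`. -/
noncomputable def normalizedSum (P : Measure Ω) (X : ι → Ω → ℝ) (d : ℕ) (ω : ℕ → Ω) :
    EuclideanSpace ℝ ι :=
  WithLp.toLp 2 fun e => (√d)⁻¹ * (∑ k ∈ Finset.range d, X e (ω k) - d * P[X e])

theorem measurable_normalizedSum (hX : ∀ e, Measurable (X e)) (d : ℕ) :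
    Measurable (normalizedSum P X d) := by
  refine (WithLp.measurable_toLp 2 _).comp (measurable_pi_lambda _ fun e => ?_)
  have := hX e
  fun_prop

variable [Fintype ι] [IsProbabilityMeasure P]

/-- The law of the normalized sums. -/
noncomputable def normalizedLaw (P : Measure Ω) [IsProbabilityMeasure P] (X : ι → Ω → ℝ)
    (hX : ∀ e, Measurable (X e)) (d : ℕ) : ProbabilityMeasure (EuclideanSpace ℝ ι) :=
  ⟨(Measure.infinitePi fun _ : ℕ => P).map (normalizedSum P X d),
    Measure.isProbabilityMeasure_map (measurable_normalizedSum hX d).aemeasurable⟩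

/-- The product of centered Gaussian measures with variances `v`. -/
noncomputable def gaussianProduct (v : ι → NNReal) : ProbabilityMeasure (EuclideanSpace ℝ ι) :=
  ⟨(Measure.pi fun e => gaussianReal 0 (v e)).map (WithLp.toLp 2),
    Measure.isProbabilityMeasure_map (WithLp.measurable_toLp 2 _).aemeasurable⟩

theorem variance_sum_mul_of_uncorrelated (hX2 : ∀ e, MemLp (X e) 2 P)
    (hcov : ∀ e f, e ≠ f → cov[X e, X f; P] = 0) (t : ι → ℝ) :
    Var[fun ω => ∑ e, t e * X e ω; P] = ∑ e, t e ^ 2 * Var[X e; P] := by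
  classical
  rw [← covariance_self (by
    exact (Finset.aemeasurable_fun_sum _ fun e _ => (hX2 e).aemeasurable.const_mul _)),
    covariance_fun_sum_fun_sum (fun e => (hX2 e).const_mul _) (fun e => (hX2 e).const_mul _)]
  refine Finset.sum_congr rfl fun e _ => ?_
  rw [Finset.sum_eq_single e]
  · rw [covariance_const_mul_left, covariance_const_mul_right,
      covariance_self (hX2 e).aemeasurable]
    ring
  · intro f _ hf
    rw [covariance_const_mul_left, covariance_const_mul_right, hcov e f hf.symm]
    simp
  · simp

/-- The **central limit theorem** for a random vector with uncorrelated coordinates. -/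
theorem tendsto_normalizedLaw (hX : ∀ e, Measurable (X e)) (hX2 : ∀ e, MemLp (X e) 2 P)
    (hcov : ∀ e f, e ≠ f → cov[X e, X f; P] = 0) :
    Tendsto (normalizedLaw P X hX) atTop
      (𝓝 (gaussianProduct fun e => Var[X e; P].toNNReal)) := by
  refine ProbabilityMeasure.tendsto_of_tendsto_charFun fun t => ?_
  -- Cramér-Wold: the linear form `⟨·, t⟩` of the normalized sum is a one-dimensional one.
  let W : Ω → ℝ := fun ω => ∑ e, t e * X e ω
  have hW : Measurable W := by fun_prop
  have hW2 : MemLp W 2 P := memLp_finsetSum _ fun e _ => (hX2 e).const_mul _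
  have hWE : P[W] = ∑ e, t e * P[X e] := by
    rw [integral_finsetSum _ fun e _ => ((hX2 e).integrable one_le_two).const_mul _]
    simp_rw [integral_const_mul]
  have hmp (k : ℕ) : MeasurePreserving (fun ω : ℕ → Ω => ω k) (Measure.infinitePi fun _ => P) P :=
    measurePreserving_eval_infinitePi _ k
  have hVar : Var[fun ω : ℕ → Ω => W (ω 0); Measure.infinitePi fun _ => P] =
      ∑ e, t e ^ 2 * Var[X e; P] := by
    rw [← variance_sum_mul_of_uncorrelated hX2 hcov, ← (hmp 0).map_eq,
      variance_map (by exact hW.aemeasurable) (hmp 0).measurable.aemeasurable, (hmp 0).map_eq]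
    rfl
  have hE : ∫ ω : ℕ → Ω, W (ω 0) ∂(Measure.infinitePi fun _ => P) = P[W] := by
    rw [← (hmp 0).map_eq, integral_map (hmp 0).measurable.aemeasurable hW.aestronglyMeasurable,
      (hmp 0).map_eq]
  have hclt := tendstoInDistribution_inv_sqrt_mul_sum_sub (P := Measure.infinitePi fun _ : ℕ => P)
    (X := fun k ω => W (ω k))
    (Y := id) (P' := gaussianReal 0
      Var[fun ω : ℕ → Ω => W (ω 0); Measure.infinitePi fun _ => P].toNNReal)
    HasLaw.id (hW2.comp_measurePreserving (hmp 0)) (iIndepFun_infinitePi fun _ => hW)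
    (fun k => ⟨(hW.comp (hmp k).measurable).aemeasurable, (hW.comp (hmp 0).measurable).aemeasurable,
      by
        rw [← Function.comp_def, ← Function.comp_def, ← Measure.map_map hW (hmp k).measurable,
          ← Measure.map_map hW (hmp 0).measurable, (hmp k).map_eq, (hmp 0).map_eq]⟩)
  have h1 := ProbabilityMeasure.tendsto_iff_tendsto_charFun.1 hclt.tendsto 1
  simp only [ProbabilityMeasure.coe_mk, Measure.map_id, charFun_gaussianReal] at h1
  have hlim : charFun (gaussianProduct fun e => Var[X e; P].toNNReal : Measure _) t =
      Complex.exp (((1 : ℝ) : ℂ) * ((0 : ℝ) : ℂ) * Complex.I -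
        ((Var[fun ω : ℕ → Ω => W (ω 0); Measure.infinitePi fun _ => P].toNNReal : ℝ) : ℂ) *
          ((1 : ℝ) : ℂ) ^ 2 / 2) := by
    rw [gaussianProduct, ProbabilityMeasure.coe_mk, charFun_pi]
    simp_rw [charFun_gaussianReal]
    rw [← Complex.exp_sum, hVar, Real.coe_toNNReal _
      (Finset.sum_nonneg fun e _ => mul_nonneg (sq_nonneg _) (variance_nonneg _ _))]
    congr 1
    simp only [Real.coe_toNNReal _ (variance_nonneg _ _)]
    push_cast
    simp only [mul_zero, zero_mul, zero_sub, one_pow, mul_one]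
    rw [Finset.sum_neg_distrib, Finset.sum_div]
    exact congrArg _ (Finset.sum_congr rfl fun e _ => by ring)
  rw [hlim]
  refine h1.congr fun d => ?_
  rw [normalizedLaw, ProbabilityMeasure.coe_mk, charFun_apply_real, charFun_apply,
    integral_map (hclt.forall_aemeasurable d) (by fun_prop),
    integral_map (measurable_normalizedSum hX d).aemeasurable (by fun_prop)]
  refine integral_congr_ae (.of_forall fun ω => ?_)
  have hinner : inner ℝ (normalizedSum P X d ω) t =
      (√d)⁻¹ * (∑ k ∈ Finset.range d, W (ω k) - d * P[W]) := by
    rw [hWE, PiLp.inner_apply]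
    simp only [normalizedSum, RCLike.inner_apply, conj_trivial, W]
    rw [Finset.sum_comm, Finset.mul_sum, ← Finset.sum_sub_distrib, Finset.mul_sum]
    refine Finset.sum_congr rfl fun e _ => ?_
    rw [← Finset.mul_sum]
    ring
  simp only [hinner, hE, Complex.ofReal_one, one_mul]

end

/-! ### Atomless laws on the line -/

theorem continuous_cdf_of_nullSingletonClass (μ : Measure ℝ) [IsProbabilityMeasure μ]
    [NullSingletonClass μ] : Continuous (cdf μ) := by
  refine continuous_iff_continuousAt.2 fun a => ?_
  rw [(monotone_cdf μ).continuousAt_iff_leftLim_eq_rightLim]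
  have h := (cdf μ).measure_singleton a
  rw [measure_cdf, measure_singleton, eq_comm, ENNReal.ofReal_eq_zero, sub_nonpos] at h
  rw [StieltjesFunction.rightLim_eq]
  exact le_antisymm ((monotone_cdf μ).leftLim_le le_rfl) h

theorem exists_seq_tendsto_cdf (μ : Measure ℝ) [IsProbabilityMeasure μ] [NullSingletonClass μ]
    {q : ℝ} (hq : q ∈ Set.Icc (0 : ℝ) 1) :
    ∃ a : ℕ → ℝ, Tendsto (fun k => μ.real (Set.Iic (a k))) atTop (𝓝 q) := by
  have hpre := (isPreconnected_range (continuous_cdf_of_nullSingletonClass μ)).closure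
  have h0 : (0 : ℝ) ∈ closure (Set.range (cdf μ)) :=
    mem_closure_of_tendsto (tendsto_cdf_atBot μ) (.of_forall fun x => ⟨x, rfl⟩)
  have h1 : (1 : ℝ) ∈ closure (Set.range (cdf μ)) :=
    mem_closure_of_tendsto (tendsto_cdf_atTop μ) (.of_forall fun x => ⟨x, rfl⟩)
  obtain ⟨y, hy, hyq⟩ := mem_closure_iff_seq_limit.1 (hpre.Icc_subset h0 h1 hq)
  choose a ha using hy
  exact ⟨a, hyq.congr fun k => by rw [← ha, cdf_eq_real]⟩

theorem nullSingletonClass_gaussianReal {v : NNReal} (hv : v ≠ 0) :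
    NullSingletonClass (gaussianReal 0 v) :=
  ⟨fun x => gaussianReal_absolutelyContinuous 0 hv (measure_singleton x)⟩

/-! ### Orthants under weak convergence -/

/-- Sublevel sets of one function are nested, so that the measure of their symmetric difference is
the difference of their measures. This controls joint probabilities by marginal ones. -/
theorem abs_measureReal_forall_le_sub_le {Ω ι : Type*} [MeasurableSpace Ω] [Fintype ι]
    (P : Measure Ω) [IsFiniteMeasure P] {f : ι → Ω → ℝ} (hf : ∀ e, Measurable (f e))
    (s a : ι → ℝ) :
    |P.real {ω | ∀ e, f e ω ≤ s e} - P.real {ω | ∀ e, f e ω ≤ a e}| ≤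
      ∑ e, |P.real {ω | f e ω ≤ s e} - P.real {ω | f e ω ≤ a e}| := by
  have hm (e : ι) (r : ℝ) : MeasurableSet {ω | f e ω ≤ r} :=
    measurableSet_le (hf e) measurable_const
  have key (s a : ι → ℝ) : P.real {ω | ∀ e, f e ω ≤ s e} ≤ P.real {ω | ∀ e, f e ω ≤ a e} +
      ∑ e, |P.real {ω | f e ω ≤ s e} - P.real {ω | f e ω ≤ a e}| := by
    have hsub : {ω | ∀ e, f e ω ≤ s e} ⊆ {ω | ∀ e, f e ω ≤ a e} ∪
        ⋃ e ∈ Finset.univ, {ω | f e ω ≤ s e} \ {ω | f e ω ≤ a e} := by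
      intro ω hω
      by_cases h : ∀ e, f e ω ≤ a e
      · exact Or.inl h
      · obtain ⟨e, he⟩ := not_forall.1 h
        exact Or.inr (Set.mem_iUnion₂.2 ⟨e, Finset.mem_univ e, hω e, he⟩)
    refine (measureReal_mono hsub).trans ((measureReal_union_le _ _).trans ?_)
    gcongr
    refine (measureReal_biUnion_finset_le _ _).trans (Finset.sum_le_sum fun e _ => ?_)
    rcases le_total (s e) (a e) with h | h
    · have hss : {ω | f e ω ≤ s e} ⊆ {ω | f e ω ≤ a e} := fun ω hω => le_trans hω h
      simp [Set.sdiff_eq_empty.2 hss]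
    · have hss : {ω | f e ω ≤ a e} ⊆ {ω | f e ω ≤ s e} := fun ω hω => le_trans hω h
      rw [measureReal_sdiff hss (hm e _)]
      exact le_abs_self _
  refine abs_le.2 ⟨?_, ?_⟩
  · have := key a s
    simp_rw [abs_sub_comm (P.real {ω | f _ ω ≤ a _})] at this
    linarith
  · have := key s a
    linarith

section
variable {ι : Type*} [Fintype ι] {γ : ι → Measure ℝ} [∀ e, IsProbabilityMeasure (γ e)]
  [∀ e, NullSingletonClass (γ e)] {μ : ProbabilityMeasure (EuclideanSpace ℝ ι)}
  {μs : ℕ → ProbabilityMeasure (EuclideanSpace ℝ ι)}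

theorem tendsto_measureReal_orthant (hμ : (μ : Measure _) = (Measure.pi γ).map (WithLp.toLp 2))
    (h : Tendsto μs atTop (𝓝 μ))
    (a : ι → ℝ) (S : Finset ι) :
    Tendsto (fun d => (μs d : Measure (EuclideanSpace ℝ ι)).real {x | ∀ e ∈ S, x e ≤ a e}) atTop
      (𝓝 (∏ e ∈ S, (γ e).real (Set.Iic (a e)))) := by
  classical
  have hclosed : IsClosed {x : EuclideanSpace ℝ ι | ∀ e ∈ S, x e ≤ a e} := by
    simp only [Set.ofPred_forall]
    exact isClosed_biInter fun e _ => isClosed_le (by fun_prop) continuous_const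
  have hopen : IsOpen {x : EuclideanSpace ℝ ι | ∀ e ∈ S, x e < a e} := by
    simp only [Set.ofPred_forall]
    exact isOpen_biInter_finset fun e _ => isOpen_lt (by fun_prop) continuous_const
  have hfr : (μ : Measure _) (frontier {x : EuclideanSpace ℝ ι | ∀ e ∈ S, x e ≤ a e}) = 0 := by
    have hsub : frontier {x : EuclideanSpace ℝ ι | ∀ e ∈ S, x e ≤ a e} ⊆ ⋃ e, {x | x e = a e} := by
      rw [hclosed.frontier_eq]
      intro x hx
      by_contra hne
      simp only [Set.mem_iUnion, Set.mem_ofPred_eq, not_exists] at hne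
      exact hx.2 (interior_maximal (fun y hy e he => (hy e he).le) hopen
        fun e he => lt_of_le_of_ne (hx.1 e he) (hne e))
    refine measure_mono_null hsub (measure_iUnion_null fun e => ?_)
    have hset : MeasurableSet {x : EuclideanSpace ℝ ι | x e = a e} :=
      measurableSet_eq_fun (by fun_prop) measurable_const
    rw [hμ, Measure.map_apply (WithLp.measurable_toLp 2 _) hset]
    have hpre : WithLp.toLp 2 ⁻¹' {x : EuclideanSpace ℝ ι | x e = a e} =
        (fun x : ι → ℝ => x e) ⁻¹' {a e} := rfl
    have hev : MeasurePreserving (fun x : ι → ℝ => x e) (Measure.pi γ) (γ e) :=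
      measurePreserving_eval γ e
    rw [hpre, hev.measure_preimage (measurableSet_singleton _).nullMeasurableSet,
      measure_singleton]
  have hlim := (ENNReal.tendsto_toReal (measure_ne_top (μ : Measure (EuclideanSpace ℝ ι))
    {x | ∀ e ∈ S, x e ≤ a e})).comp
    (ProbabilityMeasure.tendsto_measure_of_null_frontier_of_tendsto' h hfr)
  have hval : ((μ : Measure _) {x : EuclideanSpace ℝ ι | ∀ e ∈ S, x e ≤ a e}).toReal =
      ∏ e ∈ S, (γ e).real (Set.Iic (a e)) := by
    rw [hμ, Measure.map_apply (WithLp.measurable_toLp 2 _) hclosed.measurableSet]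
    have hpre : WithLp.toLp 2 ⁻¹' {x : EuclideanSpace ℝ ι | ∀ e ∈ S, x e ≤ a e} =
        Set.univ.pi fun e => if e ∈ S then Set.Iic (a e) else Set.univ := by
      ext x
      simp only [Set.mem_preimage, Set.mem_ofPred_eq, Set.mem_univ_pi]
      exact forall_congr' fun e => by by_cases he : e ∈ S <;> simp [he]
    rw [hpre, Measure.pi_pi, ENNReal.toReal_prod,
      ← Finset.prod_filter_mul_prod_filter_not Finset.univ (· ∈ S)]
    rw [Finset.prod_eq_one (s := {e | e ∉ S}) fun e he => by simp [(Finset.mem_filter.1 he).2],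
      mul_one, Finset.filter_mem_eq_inter, Finset.univ_inter]
    exact Finset.prod_congr rfl fun e he => by simp [he, measureReal_def]
  rw [← hval]
  exact hlim

/-- If laws converge weakly to a product of atomless laws, then orthants with converging marginal
probabilities have converging probabilities, whatever their (possibly divergent) corners are. -/
theorem tendsto_measureReal_orthant_of_marginals
    (hμ : (μ : Measure _) = (Measure.pi γ).map (WithLp.toLp 2))
    (h : Tendsto μs atTop (𝓝 μ)) {q : ι → ℝ} (hq : ∀ e, q e ∈ Set.Icc (0 : ℝ) 1) {s : ι → ℕ → ℝ}
    (hs : ∀ e, Tendsto (fun d => (μs d : Measure (EuclideanSpace ℝ ι)).real {x | x e ≤ s e d})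
      atTop (𝓝 (q e))) :
    Tendsto (fun d => (μs d : Measure (EuclideanSpace ℝ ι)).real {x | ∀ e, x e ≤ s e d})
      atTop (𝓝 (∏ e, q e)) := by
  classical
  choose a ha using fun e => exists_seq_tendsto_cdf (γ e) (hq e)
  have hmarg (e : ι) (r : ℝ) : Tendsto
      (fun d => (μs d : Measure (EuclideanSpace ℝ ι)).real {x | x e ≤ r}) atTop
      (𝓝 ((γ e).real (Set.Iic r))) := by
    simpa using tendsto_measureReal_orthant hμ h (fun _ => r) {e}
  rw [Metric.tendsto_nhds]
  intro ε hε
  -- Corners `a e k` with fixed limiting marginals approximate the moving corners `s e d`.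
  have hprod := tendsto_finsetProd Finset.univ fun e _ => ha e
  have hsum : Tendsto (fun k => ∑ e, |q e - (γ e).real (Set.Iic (a e k))|) atTop (𝓝 0) := by
    rw [← Finset.sum_const_zero (s := (Finset.univ : Finset ι))]
    refine tendsto_finsetSum _ fun e _ => ?_
    simpa using ((ha e).const_sub (q e)).abs
  obtain ⟨k, hk1, hk2⟩ := ((Metric.tendsto_nhds.1 hprod (ε / 3) (by positivity)).and
    (hsum.eventually_lt_const (show (0 : ℝ) < ε / 3 by positivity))).exists
  have h1 := Metric.tendsto_nhds.1 (tendsto_measureReal_orthant hμ h (fun e => a e k)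
    Finset.univ) (ε / 3) (by positivity)
  simp only [Finset.mem_univ, forall_const] at h1
  have h2 := (tendsto_finsetSum Finset.univ fun e _ =>
    ((hs e).sub (hmarg e (a e k))).abs).eventually_lt_const hk2
  filter_upwards [h1, h2] with d hd1 hd2
  have h3 := abs_measureReal_forall_le_sub_le (μs d : Measure (EuclideanSpace ℝ ι))
    (f := fun e x => x e) (fun e => by fun_prop) (fun e => s e d) (fun e => a e k)
  rw [Real.dist_eq] at *
  rw [abs_lt] at *
  rw [abs_le] at h3
  constructor <;> linarith [h3.1, h3.2, hd1.1, hd1.2, hk1.1, hk1.2]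

end

/-- The events that sums of `d` independent copies of uncorrelated variables lie below
thresholds are asymptotically independent, as soon as their probabilities stabilize. -/
theorem tendsto_measureReal_forall_sum_le {Ω ι : Type*} [MeasurableSpace Ω] [Fintype ι]
    {P : Measure Ω} [IsProbabilityMeasure P] {X : ι → Ω → ℝ} (hX : ∀ e, Measurable (X e))
    (hX2 : ∀ e, MemLp (X e) 2 P) (hcov : ∀ e f, e ≠ f → cov[X e, X f; P] = 0)
    (hvar : ∀ e, Var[X e; P] ≠ 0) {q : ι → ℝ} (hq : ∀ e, q e ∈ Set.Icc (0 : ℝ) 1)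
    {s : ι → ℕ → ℝ}
    (hs : ∀ e, ∀ᶠ d in atTop, (Measure.infinitePi fun _ : ℕ => P).real
      {ω | ∑ k ∈ Finset.range d, X e (ω k) ≤ s e d} = q e) :
    Tendsto (fun d => (Measure.infinitePi fun _ : ℕ => P).real
      {ω | ∀ e, ∑ k ∈ Finset.range d, X e (ω k) ≤ s e d}) atTop (𝓝 (∏ e, q e)) := by
  have hv (e : ι) : Var[X e; P].toNNReal ≠ 0 := by
    rw [Ne, Real.toNNReal_eq_zero, not_le]
    exact lt_of_le_of_ne (variance_nonneg _ _) (hvar e).symm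
  have (e : ι) : NullSingletonClass (gaussianReal 0 Var[X e; P].toNNReal) :=
    nullSingletonClass_gaussianReal (hv e)
  have hiff (d : ℕ) (hd : 0 < d) (ω : ℕ → Ω) (e : ι) :
      normalizedSum P X d ω e ≤ (√d)⁻¹ * (s e d - d * P[X e]) ↔
        ∑ k ∈ Finset.range d, X e (ω k) ≤ s e d := by
    have : 0 < (√d)⁻¹ := by positivity
    change (√d)⁻¹ * (_ - _) ≤ _ ↔ _
    rw [mul_le_mul_iff_right₀ this, sub_le_sub_iff_right]
  have h := tendsto_measureReal_orthant_of_marginals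
    (s := fun e d => (√d)⁻¹ * (s e d - d * P[X e])) rfl (tendsto_normalizedLaw hX hX2 hcov) hq
    fun e => by
      refine tendsto_const_nhds.congr' ?_
      filter_upwards [hs e, eventually_gt_atTop 0] with d hd hd0
      rw [← hd, normalizedLaw, ProbabilityMeasure.coe_mk, map_measureReal_apply
        (measurable_normalizedSum hX d) (measurableSet_le (by fun_prop) measurable_const)]
      congr 1
      ext ω
      exact (hiff d hd0 ω e).symm
  refine h.congr' ?_
  filter_upwards [eventually_gt_atTop 0] with d hd0
  rw [normalizedLaw, ProbabilityMeasure.coe_mk, map_measureReal_apply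
    (measurable_normalizedSum hX d)]
  · congr 1
    ext ω
    exact forall_congr' fun e => hiff d hd0 ω e
  · rw [Set.ofPred_forall]
    exact .iInter fun e => measurableSet_le (by fun_prop) measurable_const

/-! ### Balls of the torus -/

theorem lpDist_sub_zero (p : ℝ≥0∞) {d : ℕ} (x y : UnitAddTorus (Fin d)) :
    lpDist p (x - y) 0 = lpDist p x y := by
  simp [lpDist]

theorem lpDist_top_le_iff {d : ℕ} (hd : 0 < d) (x y : UnitAddTorus (Fin d)) (t : ℝ) :
    lpDist ∞ x y ≤ t ↔ ∀ i, ‖x i - y i‖ ≤ t := by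
  have : Nonempty (Fin d) := ⟨⟨0, hd⟩⟩
  rw [lpDist, if_pos rfl]
  exact ciSup_le_iff (Set.finite_range _).bddAbove

section
variable {p : ℝ≥0∞}

theorem lpDist_nonneg (hpt : p ≠ ∞) {d : ℕ} (x y : UnitAddTorus (Fin d)) : 0 ≤ lpDist p x y := by
  rw [lpDist, if_neg hpt]
  positivity

theorem lpDist_rpow (hp : 1 ≤ p) (hpt : p ≠ ∞) {d : ℕ} (x y : UnitAddTorus (Fin d)) :
    lpDist p x y ^ p.toReal = ∑ i, ‖x i - y i‖ ^ p.toReal := by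
  have hp0 : 0 < p.toReal := ENNReal.toReal_pos (by positivity) hpt
  rw [lpDist, if_neg hpt, one_div, Real.rpow_inv_rpow (by positivity) hp0.ne']

theorem lpDist_le_iff (hp : 1 ≤ p) (hpt : p ≠ ∞) {d : ℕ} (x y : UnitAddTorus (Fin d)) {t : ℝ}
    (ht : 0 ≤ t) : lpDist p x y ≤ t ↔ ∑ i, ‖x i - y i‖ ^ p.toReal ≤ t ^ p.toReal := by
  have hp0 : 0 < p.toReal := ENNReal.toReal_pos (by positivity) hpt
  rw [← lpDist_rpow hp hpt, Real.rpow_le_rpow_iff (lpDist_nonneg hpt x y) ht hp0]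

theorem volume_norm_add_eq_eq_zero (z : UnitAddCircle) (r : ℝ) :
    volume {c : UnitAddCircle | ‖z + c‖ = r} = 0 := by
  have h : {c : UnitAddCircle | ‖z + c‖ = r} ⊆
      Metric.closedBall (-z) r \ Metric.ball (-z) r := by
    intro c hc
    have hc' : ‖z + c‖ = r := hc
    simp [← hc', add_comm]
  exact measure_mono_null h (ae_le_set.1 AddCircle.closedBall_ae_eq_ball.le)

theorem volume_lpDist_zero_eq_eq_zero (hp : 1 ≤ p) (hpt : p ≠ ∞) {d : ℕ} (hd : 0 < d) (r : ℝ) :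
    volume {x : UnitAddTorus (Fin d) | lpDist p x 0 = r} = 0 := by
  have hp0 : 0 < p.toReal := ENNReal.toReal_pos (by positivity) hpt
  let i₀ : Fin d := ⟨0, hd⟩
  -- Translating the zeroth coordinate by a uniform amount preserves the uniform law.
  have hmp := measurePreserving_add_single (K := UnitAddCircle) i₀
  have hmeas : MeasurableSet {x : UnitAddTorus (Fin d) | lpDist p x 0 = r} :=
    measurableSet_eq_fun ((measurable_lpDist p).comp
      (f := fun x : UnitAddTorus (Fin d) => (x, 0)) (by fun_prop)) measurable_const
  rw [← hmp.measure_preimage hmeas.nullMeasurableSet,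
    Measure.measure_prod_null (hmp.measurable hmeas)]
  refine .of_forall fun x => ?_
  refine measure_mono_null (fun c hc => ?_) (volume_norm_add_eq_eq_zero (x i₀)
    ((r ^ p.toReal - ∑ i ∈ Finset.univ.erase i₀, ‖x i‖ ^ p.toReal) ^ p.toReal⁻¹))
  have hc' : lpDist p (x + Pi.single i₀ c : UnitAddTorus (Fin d)) 0 = r := hc
  have hsum := lpDist_rpow hp hpt (x + Pi.single i₀ c : UnitAddTorus (Fin d)) 0
  rw [hc', ← Finset.add_sum_erase _ _ (Finset.mem_univ i₀)] at hsum
  have hrest : ∑ i ∈ Finset.univ.erase i₀,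
      ‖(x + Pi.single i₀ c : UnitAddTorus (Fin d)) i - (0 : UnitAddTorus (Fin d)) i‖ ^ p.toReal =
      ∑ i ∈ Finset.univ.erase i₀, ‖x i‖ ^ p.toReal :=
    Finset.sum_congr rfl fun i hi => by simp [Finset.ne_of_mem_erase hi]
  rw [hrest] at hsum
  change ‖x i₀ + c‖ = _
  rw [hsum, add_sub_cancel_right, Real.rpow_rpow_inv (norm_nonneg _) hp0.ne']
  simp

/-- The ball volume is a continuous function of the radius that grows from `0` to `1`, so that the
set defining the threshold is nonempty and closed, and its infimum is attained. -/
theorem threshold_mem (hp : 1 ≤ p) (hpt : p ≠ ∞) {d : ℕ} (hd : 0 < d) {q : ℝ} (hq : 0 ≤ q) :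
    0 ≤ threshold p d q ∧ ballVolume p d (threshold p d q) = min 1 q := by
  have hg : Measurable fun x : UnitAddTorus (Fin d) => lpDist p x 0 :=
    (measurable_lpDist p).comp (f := fun x : UnitAddTorus (Fin d) => (x, 0)) (by fun_prop)
  let μ : Measure ℝ := (volume : Measure (UnitAddTorus (Fin d))).map fun x => lpDist p x 0
  have hprob : IsProbabilityMeasure μ := Measure.isProbabilityMeasure_map hg.aemeasurable
  have hnull : NullSingletonClass μ := ⟨fun r => by
    rw [Measure.map_apply hg (measurableSet_singleton r)]
    exact volume_lpDist_zero_eq_eq_zero hp hpt hd r⟩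
  have hvol (r : ℝ) : ballVolume p d r = cdf μ r := by
    rw [cdf_eq_real, map_measureReal_apply hg measurableSet_Iic]
    rfl
  have hcont : Continuous (ballVolume p d) := by
    rw [show ballVolume p d = cdf μ from funext hvol]
    exact continuous_cdf_of_nullSingletonClass μ
  have h0 : ballVolume p d 0 = 0 := by
    have : {x : UnitAddTorus (Fin d) | lpDist p x 0 ≤ 0} ⊆ {x | lpDist p x 0 = 0} :=
      fun x hx => le_antisymm hx (lpDist_nonneg hpt x 0)
    rw [ballVolume, measureReal_def,
      measure_mono_null this (volume_lpDist_zero_eq_eq_zero hp hpt hd 0), ENNReal.toReal_zero]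
  have h1 : ballVolume p d ((d : ℝ) ^ p.toReal⁻¹) = 1 := by
    have hp0 : 0 < p.toReal := ENNReal.toReal_pos (by positivity) hpt
    have : {x : UnitAddTorus (Fin d) | lpDist p x 0 ≤ (d : ℝ) ^ p.toReal⁻¹} = Set.univ := by
      refine Set.eq_univ_of_forall fun x => ?_
      change lpDist p x 0 ≤ _
      rw [lpDist_le_iff hp hpt _ _ (by positivity), Real.rpow_inv_rpow (by positivity) hp0.ne']
      refine (Finset.sum_le_card_nsmul _ _ 1 fun i _ => ?_).trans (by simp)
      refine Real.rpow_le_one (norm_nonneg _) ?_ hp0.le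
      have := AddCircle.norm_le_half_period (p := 1) (x := x i - (0 : UnitAddTorus (Fin d)) i)
        one_ne_zero
      norm_num at this ⊢
      linarith
    rw [ballVolume, this, probReal_univ]
  rw [threshold, if_neg hpt]
  change sInf {r : ℝ | 0 ≤ r ∧ ballVolume p d r = min 1 q} ∈
    {r : ℝ | 0 ≤ r ∧ ballVolume p d r = min 1 q}
  refine IsClosed.csInf_mem ?_ ?_ ⟨0, fun r hr => hr.1⟩
  · exact (isClosed_le continuous_const continuous_id).inter
      (isClosed_eq hcont continuous_const)
  · obtain ⟨r, hr, hrq⟩ := intermediate_value_Icc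
      (show (0 : ℝ) ≤ (d : ℝ) ^ p.toReal⁻¹ by positivity) hcont.continuousOn
      (show min 1 q ∈ Set.Icc (ballVolume p d 0) (ballVolume p d _) by
        rw [h0, h1]; exact ⟨le_min zero_le_one hq, min_le_left _ _⟩)
    exact ⟨r, hr.1, hrq⟩

end

theorem volume_real_lpDist_le {n : ℕ} (p : ℝ≥0∞) (d : ℕ) {u v : Fin n} (h : u ≠ v) (t : ℝ) :
    (volume : Measure (Fin n → UnitAddTorus (Fin d))).real {x | lpDist p (x u) (x v) ≤ t} =
      ballVolume p d t := by
  have hmeas : MeasurableSet {x : UnitAddTorus (Fin d) | lpDist p x 0 ≤ t} :=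
    measurableSet_le ((measurable_lpDist p).comp
      (f := fun x : UnitAddTorus (Fin d) => (x, 0)) (by fun_prop)) measurable_const
  rw [ballVolume, ← (measurePreserving_sub_eval h).measureReal_preimage hmeas.nullMeasurableSet]
  congr 1
  ext x
  change _ ↔ lpDist p (x u - x v) 0 ≤ t
  rw [lpDist_sub_zero]
  rfl

/-! ### Distances between two positions on the circle -/

section
variable {n : ℕ}

theorem measurable_norm_sub_rpow (r : ℝ) (u v : Fin n) :
    Measurable fun y : Fin n → UnitAddCircle => ‖y u - y v‖ ^ r := by
  have h : Measurable fun y : Fin n → UnitAddCircle => y u - y v := by fun_prop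
  exact (continuous_norm.measurable.comp h).pow_const r

theorem memLp_norm_sub_rpow {r : ℝ} (hr : 0 ≤ r) (u v : Fin n) (s : ℝ≥0∞) :
    MemLp (fun y : Fin n → UnitAddCircle => ‖y u - y v‖ ^ r) s volume := by
  refine MemLp.of_bound (measurable_norm_sub_rpow r u v).aestronglyMeasurable 1
    (.of_forall fun y => ?_)
  rw [Real.norm_of_nonneg (by positivity)]
  refine Real.rpow_le_one (norm_nonneg _) ?_ hr
  have := AddCircle.norm_le_half_period (p := 1) (x := y u - y v) one_ne_zero
  norm_num at this
  linarith

/-- The variance is nonzero because the distance of two uniform positions has no atoms. -/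
theorem variance_norm_sub_rpow_ne_zero {r : ℝ} (hr : 0 < r) {u v : Fin n} (h : u ≠ v) :
    Var[fun y : Fin n → UnitAddCircle => ‖y u - y v‖ ^ r; volume] ≠ 0 := by
  intro h0
  have hae := ae_eq_integral_of_variance_eq_zero (memLp_norm_sub_rpow hr.le u v 2) h0
  set m := ∫ y : Fin n → UnitAddCircle, ‖y u - y v‖ ^ r
  have hnull : ∀ᵐ c : UnitAddCircle, ‖c‖ ≠ m ^ r⁻¹ := by
    refine measure_mono_null (fun c hc => ?_) (volume_norm_add_eq_eq_zero 0 (m ^ r⁻¹))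
    simpa using hc
  have hne := (measurePreserving_sub_eval (K := UnitAddCircle) h).quasiMeasurePreserving.ae hnull
  obtain ⟨y, hy, hy'⟩ := (hae.and hne).exists
  rw [← hy, Real.rpow_rpow_inv (norm_nonneg _) hr.ne'] at hy'
  exact hy' rfl

theorem indepFun_sub {a b u v : Fin n} (hab : a ≠ b) (huv : u ≠ v) (h : s(a, b) ≠ s(u, v)) :
    IndepFun (fun y : Fin n → UnitAddCircle => y a - y b) (fun y => y u - y v) volume := by
  rw [indepFun_iff_hasLaw_prodMk_prod (measurePreserving_sub_eval hab).hasLaw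
    (measurePreserving_sub_eval huv).hasLaw]
  exact (measurePreserving_sub_eval_prodMk hab huv h).hasLaw

end

/-! ### The edges of the geometric graph, coordinate by coordinate -/

theorem measurePreserving_coordinates (n d : ℕ) :
    MeasurePreserving (fun (ω : ℕ → Fin n → UnitAddCircle) (i : Fin n) (k : Fin d) => ω k i)
      (Measure.infinitePi fun _ => volume) volume := by
  have hres : MeasurePreserving (fun (ω : ℕ → Fin n → UnitAddCircle) (k : Fin d) => ω k)
      (Measure.infinitePi fun _ => volume) volume := by
    refine ⟨measurable_pi_lambda _ fun k => measurable_pi_apply (k : ℕ), ?_⟩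
    rw [Measure.map_infinitePi_infinitePi_of_inj (P := fun _ : ℕ => volume)
      (f := fun k : Fin d => (k : ℕ)) Fin.val_injective, Measure.infinitePi_eq_pi]
    rfl
  exact measurePreserving_swap_pi.comp hres

section
variable {n : ℕ} {ι : Type*} [Fintype ι] {a b : ι → Fin n}

theorem measurableSet_forall_lpDist_le (p : ℝ≥0∞) (d : ℕ) (t : ι → ℝ) :
    MeasurableSet {x : Fin n → UnitAddTorus (Fin d) | ∀ e, lpDist p (x (a e)) (x (b e)) ≤ t e} := by
  rw [Set.ofPred_forall]
  exact .iInter fun e => measurableSet_le ((measurable_lpDist p).comp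
    (f := fun x : Fin n → UnitAddTorus (Fin d) => (x (a e), x (b e))) (by fun_prop))
    measurable_const

/-- The coordinates are independent, and the maximum norm bounds each of them. -/
theorem volume_real_forall_lpDist_top_le {d : ℕ} (hd : 0 < d) (t : ι → ℝ) :
    (volume : Measure (Fin n → UnitAddTorus (Fin d))).real
        {x | ∀ e, lpDist ∞ (x (a e)) (x (b e)) ≤ t e} =
      (volume : Measure (Fin n → UnitAddCircle)).real
        {y | ∀ e, ‖y (a e) - y (b e)‖ ≤ t e} ^ d := by
  rw [← (measurePreserving_swap_pi (K := UnitAddCircle) (ι := Fin n)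
    (κ := Fin d)).measureReal_preimage (measurableSet_forall_lpDist_le _ _ _).nullMeasurableSet]
  have hpre : (fun (x : Fin d → Fin n → UnitAddCircle) i k => x k i) ⁻¹'
      {x : Fin n → UnitAddTorus (Fin d) | ∀ e, lpDist ∞ (x (a e)) (x (b e)) ≤ t e} =
      Set.univ.pi fun _ => {y | ∀ e, ‖y (a e) - y (b e)‖ ≤ t e} := by
    ext x
    simp only [Set.mem_preimage, Set.mem_ofPred_eq, lpDist_top_le_iff hd, Set.mem_univ_pi]
    exact forall_comm
  rw [hpre, measureReal_def, volume_pi, Measure.pi_pi, ENNReal.toReal_prod]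
  simp [measureReal_def]

theorem volume_real_forall_lpDist_le {p : ℝ≥0∞} (hp : 1 ≤ p) (hpt : p ≠ ∞) (d : ℕ) {t : ι → ℝ}
    (ht : ∀ e, 0 ≤ t e) :
    (volume : Measure (Fin n → UnitAddTorus (Fin d))).real
        {x | ∀ e, lpDist p (x (a e)) (x (b e)) ≤ t e} =
      (Measure.infinitePi fun _ : ℕ => (volume : Measure (Fin n → UnitAddCircle))).real
        {ω | ∀ e, ∑ k ∈ Finset.range d, ‖ω k (a e) - ω k (b e)‖ ^ p.toReal ≤
          t e ^ p.toReal} := by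
  rw [← (measurePreserving_coordinates n d).measureReal_preimage
    (measurableSet_forall_lpDist_le _ _ _).nullMeasurableSet]
  congr 1
  ext ω
  simp only [Set.mem_preimage, Set.mem_ofPred_eq]
  refine forall_congr' fun e => ?_
  rw [lpDist_le_iff hp hpt _ _ (ht e),
    Fin.sum_univ_eq_sum_range fun k => ‖ω k (a e) - ω k (b e)‖ ^ p.toReal]

/-- Finitely many distinct pairs are asymptotically joined independently. -/
theorem tendsto_volume_real_forall_lpDist_le_threshold {p : ℝ≥0∞} (hp : 1 ≤ p)
    (hab : ∀ e, a e ≠ b e) (hinj : ∀ e f, e ≠ f → s(a e, b e) ≠ s(a f, b f))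
    {q : ι → ℝ} (hq : ∀ e, 0 ≤ q e) :
    Tendsto (fun d : ℕ => (volume : Measure (Fin n → UnitAddTorus (Fin d))).real
      {x | ∀ e, lpDist p (x (a e)) (x (b e)) ≤ threshold p d (q e)}) atTop
      (𝓝 (∏ e, min 1 (q e))) := by
  by_cases hpt : p = ∞
  · subst hpt
    refine (tendsto_measureReal_norm_le_pow
      (Y := fun e (y : Fin n → UnitAddCircle) => y (a e) - y (b e))
      (fun e => measurePreserving_sub_eval (hab e))
      (fun e f hef => indepFun_sub (hab e) (hab f) (hinj e f hef)) hq).congr' ?_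
    filter_upwards [eventually_gt_atTop 0] with d hd
    rw [volume_real_forall_lpDist_top_le hd]
    simp [threshold]
  · have hp0 : 0 < p.toReal := ENNReal.toReal_pos (by positivity) hpt
    have hnorm : Measurable fun c : UnitAddCircle => ‖c‖ ^ p.toReal :=
      continuous_norm.measurable.pow_const _
    refine (tendsto_measureReal_forall_sum_le
      (X := fun e (y : Fin n → UnitAddCircle) => ‖y (a e) - y (b e)‖ ^ p.toReal)
      (s := fun e d => threshold p d (q e) ^ p.toReal)
      (fun e => measurable_norm_sub_rpow _ _ _) (fun e => memLp_norm_sub_rpow hp0.le _ _ _)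
      (fun e f hef => ((indepFun_sub (hab e) (hab f) (hinj e f hef)).comp
        hnorm hnorm).covariance_eq_zero
        (memLp_norm_sub_rpow hp0.le _ _ _) (memLp_norm_sub_rpow hp0.le _ _ _))
      (fun e => variance_norm_sub_rpow_ne_zero hp0 (hab e))
      (fun e => ⟨le_min zero_le_one (hq e), min_le_left _ _⟩) fun e => ?_).congr' ?_
    · filter_upwards [eventually_gt_atTop 0] with d hd
      obtain ⟨ht, hvol⟩ := threshold_mem hp hpt hd (hq e)
      have h := volume_real_forall_lpDist_le (ι := Unit) (a := fun _ => a e) (b := fun _ => b e)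
        hp hpt d (t := fun _ => threshold p d (q e)) fun _ => ht
      simp only [forall_const] at h
      rw [← h, volume_real_lpDist_le p d (hab e), hvol]
    · filter_upwards [eventually_gt_atTop 0] with d hd
      exact (volume_real_forall_lpDist_le hp hpt d fun e =>
        (threshold_mem hp hpt hd (hq e)).1).symm

end

theorem coe_edgeProb_mk {n : ℕ} {lam : ℝ} {w : Fin n → ℝ} {u v : Fin n}
    (h : 0 ≤ ratio lam w u v) : (edgeProb lam w s(u, v) : ℝ) = min 1 (ratio lam w u v) := by
  rw [edgeProb, Set.coe_projIcc, Sym2.lift_mk]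
  exact max_eq_right (le_min zero_le_one h)

end GIRG

theorem mainTheorem1 (p : ℝ≥0∞) (hp : 1 ≤ p) (n : ℕ) (lam : ℝ) (hlam : 0 < lam)
    (w : Fin n → ℝ) (hw : ∀ v, 0 ≤ w v) :
    Tendsto (fun d : ℕ => GIRG.tvDist (GIRG.girgLaw p d lam w) (GIRG.irgLaw lam w))
      atTop (𝓝 0) := by
  classical
  refine GIRG.tendsto_tvDist_of_tendsto_singleton
    (GIRG.tendsto_singleton_of_tendsto_Ici fun H => ?_)
  have hratio (u v : Fin n) : 0 ≤ GIRG.ratio lam w u v := by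
    have := hw u
    have := hw v
    unfold GIRG.ratio
    positivity
  have hend (e : H.edgeSet) : ∃ u v, s(u, v) = e.1 := e.1.ind fun u v => ⟨u, v, rfl⟩
  choose a b hab using hend
  rw [GIRG.irgLaw_real_Ici]
  simp_rw [GIRG.girgLaw_real_Ici, ← hab, GIRG.coe_edgeProb_mk (hratio _ _)]
  refine (GIRG.tendsto_volume_real_forall_lpDist_le_threshold (a := a) (b := b) hp (fun e => ?_)
    (fun e f hef => by rw [hab, hab]; exact Subtype.coe_injective.ne hef)
    (fun e => hratio (a e) (b e))).congr fun d => ?_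
  · have he : H.Adj (a e) (b e) := by
      rw [← SimpleGraph.mem_edgeSet, hab]
      exact e.2
    exact he.ne
  · congr 1
    ext x
    refine ⟨fun h u v huv => ?_, fun h e => h _ _ ?_⟩
    · have h' := h ⟨s(u, v), huv⟩
      rcases Sym2.eq_iff.1 (hab ⟨s(u, v), huv⟩) with ⟨h1, h2⟩ | ⟨h1, h2⟩
      · rwa [h1, h2] at h'
      · rwa [h1, h2, GIRG.lpDist_comm, GIRG.ratio_comm] at h'
    · rw [← SimpleGraph.mem_edgeSet, hab]
      exact e.2
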